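/- **Conventions.** A (natural) polydifferential operator $D$ of rank $r$ on $n$-manifolds assigns to each Riemannian $n$-manifold $(M,g)$ a linear operator $D^g\colon C^\infty(M)^{\otimes(r-1)}\to C^\infty(M)$ such that $D^g(u_1\otimes\dotsm\otimes u_{r-1})$ is a universal real linear combination of complete contractions (with $g^{-1}$) of tensors $\nabla^{N_1}\mathrm{Rm}\otimes\dotsm\otimes\nabla^{N_m}\mathrm{Rm}\otimes\nabla^{N_{m+1}}u_1\otimes\dotsm\otimes\nabla^{N_{m+r-1}}u_{r-1}$. It is *formally self-adjoint* if its Dirichlet form $(u_1,\dotsc,u_r)\mapsto\int_M u_1D^g(u_2\otimes\dotsm\otimes u_r)\,\mathrm{dvol}_g$ on compactly supported smooth functions is symmetric; it is *conformally covariant* if there are $a_1,\dotsc,a_{r-1},b\in\mathbb{R}$ with $D^{e^{2\Upsilon}g}(u_1\otimes\dotsm\otimes u_{r-1})=e^{b\Upsilon}D^g(e^{-a_1\Upsilon}u_1\otimes\dotsm\otimes e^{-a_{r-1}\Upsilon}u_{r-1})$; it has *homogeneity* $-2k$ if $D^{c^2g}=c^{-2k}D^g$ for all constants $c>0$. For a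 multilinear operator $T$, $[T,f]_1(u_1\otimes\dotsm\otimes u_\ell):=T(fu_1\otimes u_2\otimes\dotsm\otimes u_\ell)-fT(u_1\otimes\dotsm\otimes u_\ell)$. Let $(M,\mathfrak{c})$ be a conformal $n$-manifold and let $\mathcal{G}=\{(x,g_x):x\in M,\ g\in\mathfrak{c}\}$, with dilations $\delta_s(x,g_x)=(x,s^2g_x)$. An *ambient space* is an open subset $\widetilde{\mathcal{G}}\subseteq\mathcal{G}\times\mathbb{R}_\rho$ (or a manifold identified with one), invariant under the dilations of the first factor and containing $\mathcal{G}\times\{0\}$, with a pseudo-Riemannian metric $\widetilde g$ that is homogeneous of degree $2$, restricts to the tautological tensor on $\mathcal{G}$, and satisfies $\mathrm{Ric}(\widetilde g)=O(\rho^\infty)$ if $n=2$ or $n$ is odd, and $\mathrm{Ric}(\widetilde g)=O^+(\rho^{n/2-1})$ if $n\ge4$ is even. Here $T=O^+(\rho^m)$ means that $T=O(\rho^m)$ and that, at each $(x,g_x)\in\mathcal{G}$, the restriction of $\rho^{-m}T$ to $\mathcal{G}$ is the pullback of a symmetric bilinear form on $T_xM$ that is trace-free with respect to $g_x$. Write $\iota\colon\mathcal{G}\to\widetilde{\mathcal{G}}$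 for the inclusion as $\mathcal{G}\times\{0\}$, and $\widetilde{\mathcal{E}}[w]$ for the smooth functions on $\widetilde{\mathcal{G}}$ that are homogeneous of weight $w$ under dilations. For $g\in\mathfrak{c}$ put $\widetilde u|_{(M,g)}(x):=\widetilde u(\iota(x,g_x))$, and call $\widetilde u$ a *homogeneous extension* of $\widetilde u|_{(M,g)}$. A natural polydifferential operator $\widetilde D\colon\widetilde{\mathcal{E}}[a_1]\otimes\dotsm\otimes\widetilde{\mathcal{E}}[a_\ell]\to\widetilde{\mathcal{E}}[b]$ on the ambient spaces of conformal $n$-manifolds *defines $D$ holographically* if it is tangential (that is, $\iota^*\widetilde D(\widetilde u_1\otimes\dotsm\otimes\widetilde u_\ell)$ depends only on the $\iota^*\widetilde u_j$ and on $\widetilde g$, modulo $O^+(\rho^{n/2})$ if $n$ is even) and $D^g(u_1\otimes\dotsm\otimes u_\ell)=\widetilde D(\widetilde u_1\otimes\dotsm\otimes\widetilde u_\ell)|_{(M,g)}$ for all ambient spaces, all $g\in\mathfrak{c}$, and all homogeneous extensions $\widetilde u_j\in\widetilde{\mathcal{E}}[a_j]$ of $u_j\in C^\infty(M)$. A *Weyl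 operator* is a conformally covariant polydifferential operator that is defined holographically by some $\widetilde D$. **Lemma.** Let $r\ge2$ and $k\ge0$ be integers, and let $D$ be a formally self-adjoint, conformally covariant, polydifferential Weyl operator of rank $r$ and homogeneity $-2k$ on $n$-manifolds, defined holographically by $$\widetilde D\colon\widetilde{\mathcal{E}}\Bigl[-\tfrac{n-2k}{r}\Bigr]^{\otimes(r-1)}\to\widetilde{\mathcal{E}}\Bigl[-\tfrac{(r-1)n+2k}{r}\Bigr].$$ Let $S^n\subset\mathbb{R}^{n+1}$ be the unit sphere with its round metric $d\theta^2$, and let $x^0,\dotsc,x^n$ be the restrictions of the Cartesian coordinates to $S^n$. Let the flat ambient space $\widetilde{\mathcal{G}}$ of $S^n$ be any open subset of $\mathbb{R}_{\widetilde t}\times\mathbb{R}^{n+1}_{\widetilde x}$ that is invariant under the dilations $p\mapsto sp$, $s>0$, and contains the future light cone $\{\widetilde t=|\widetilde x|>0\}$, with the metric $-d\widetilde t^{\,2}+\sum_{i=0}^n(d\widetilde x^i)^2$; the restriction to $(S^n,d\theta^2)$ of a function on $\widetilde{\mathcal{G}}$ is its restriction to $\{\widetilde t=1,\ |\widetilde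 x|=1\}$. Let $u,v\in C^\infty(S^n)$, and let $\widetilde u\in\widetilde{\mathcal{E}}[-\frac{n-2k}{r}-1]$ and $\widetilde v\in\widetilde{\mathcal{E}}[-\frac{n-2k}{r}]$ be homogeneous extensions of $u$ and $v$ to $\widetilde{\mathcal{G}}$. Then $$\sum_{i=0}^n x^i[D^{d\theta^2},x^i]_1\bigl(u\otimes v^{\otimes(r-2)}\bigr)=\sum_{i=0}^n\Bigl(\widetilde x^i\,\widetilde t\,\widetilde D\bigl(\widetilde x^i\widetilde u\otimes\widetilde v^{\otimes(r-2)}\bigr)-(\widetilde x^i)^2\,\widetilde D\bigl(\widetilde t\,\widetilde u\otimes\widetilde v^{\otimes(r-2)}\bigr)\Bigr)\Big|_{(S^n,d\theta^2)}.$$ -/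

import Mathlib

open scoped Manifold ContDiff

noncomputable section

namespace Ambient

/-! ## Tensor calculus in a coordinate domain of `ℝ^d` -/

/-- The model space `ℝ^d`. -/
abbrev E (d : ℕ) := EuclideanSpace ℝ (Fin d)

/-- The partial derivative of `f` in the `i`-th coordinate direction. -/
def partialD {d : ℕ} (i : Fin d) (f : E d → ℝ) (y : E d) : ℝ :=
  fderiv ℝ f y (EuclideanSpace.single i 1)

/-- Covariant tensor fields of rank `m`, through their components in coordinates. -/
abbrev CoordTensor (d m : ℕ) := E d → (Fin m → Fin d) → ℝ

/-- Christoffel symbols `Γ^l_{ij}` of the metric with component matrix `G`. -/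
def christoffel {d : ℕ} (G : E d → Matrix (Fin d) (Fin d) ℝ) (l i j : Fin d) (y : E d) : ℝ :=
  (1 / 2 : ℝ) * ∑ m, (G y)⁻¹ l m *
    (partialD i (fun z => G z m j) y + partialD j (fun z => G z m i) y
      - partialD m (fun z => G z i j) y)

/-- The components `R^l_{kij}` of the curvature, `R(∂_i, ∂_j) ∂_k = R^l_{kij} ∂_l`. -/
def riemannUp {d : ℕ} (G : E d → Matrix (Fin d) (Fin d) ℝ) (l k i j : Fin d) (y : E d) : ℝ :=
  partialD i (christoffel G l j k) y - partialD j (christoffel G l i k) y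
    + ∑ m, (christoffel G l i m y * christoffel G m j k y
        - christoffel G l j m y * christoffel G m i k y)

/-- The Riemann curvature tensor with all indices lowered:
the component at `(i, j, k, m)` is `⟨R(∂_i, ∂_j) ∂_k, ∂_m⟩`. -/
def riemann {d : ℕ} (G : E d → Matrix (Fin d) (Fin d) ℝ) : CoordTensor d 4 :=
  fun y I => ∑ l, G y (I 3) l * riemannUp G l (I 2) (I 0) (I 1) y

/-- The components of the Ricci tensor, `Ric_{jk} = R^i_{kij}`. -/
def ricciCoord {d : ℕ} (G : E d → Matrix (Fin d) (Fin d) ℝ) (y : E d) :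
    Matrix (Fin d) (Fin d) ℝ :=
  fun j k => ∑ i, riemannUp G i k i j y

/-- The covariant derivative `∇T` of a covariant tensor field; the new index comes first. -/
def covDeriv {d m : ℕ} (G : E d → Matrix (Fin d) (Fin d) ℝ) (T : CoordTensor d m) :
    CoordTensor d (m + 1) :=
  fun y I => partialD (I 0) (fun z => T z (Fin.tail I)) y
    - ∑ s : Fin m, ∑ l : Fin d,
        christoffel G l (I 0) (I s.succ) y * T y (Function.update (Fin.tail I) s l)

/-- The iterated covariant derivative `∇^N T`. -/
def iterCovDeriv {d m : ℕ} (G : E d → Matrix (Fin d) (Fin d) ℝ) (T : CoordTensor d m) :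
    (N : ℕ) → CoordTensor d (m + N)
  | 0 => T
  | N + 1 => covDeriv G (iterCovDeriv G T N)

/-! ## Metrics on manifolds -/

/-- Fields of bilinear forms on the tangent spaces of a `d`-manifold (no regularity yet). -/
abbrev BilinField (d : ℕ) (M : Type) [TopologicalSpace M] [ChartedSpace (E d) M] :=
  (p : M) → LinearMap.BilinForm ℝ (TangentSpace (𝓡 d) p)

section Metrics

variable {d : ℕ} {M : Type} [TopologicalSpace M] [ChartedSpace (E d) M]

/-- The components of a field of bilinear forms in the preferred chart at `p`, as functions of
the coordinates `y`. -/
def comps (T : BilinField d M) (p : M) (y : E d) : Matrix (Fin d) (Fin d) ℝ :=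
  fun i j =>
    let φ := (extChartAt (𝓡 d) p).symm
    T (φ y) (mfderiv (𝓡 d) (𝓡 d) φ y (EuclideanSpace.single i (1 : ℝ)))
      (mfderiv (𝓡 d) (𝓡 d) φ y (EuclideanSpace.single j (1 : ℝ)))

/-- The field of bilinear forms is smooth at `p`. -/
def SmoothFieldAt (T : BilinField d M) (p : M) : Prop :=
  ∀ i j, ContDiffAt ℝ ∞ (fun y => comps T p y i j) (extChartAt (𝓡 d) p p)

/-- `g` is a smooth pseudo-Riemannian metric on the set `U`. -/
structure IsPseudoRiemannianOn (g : BilinField d M) (U : Set M) : Prop where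
  symm : ∀ p ∈ U, ∀ v w, g p v w = g p w v
  nondegenerate : ∀ p ∈ U, ∀ v, (∀ w, g p v w = 0) → v = 0
  smooth : ∀ p ∈ U, SmoothFieldAt g p

/-- `g` is a smooth Riemannian metric. -/
structure IsRiemannian (g : BilinField d M) : Prop where
  symm : ∀ p v w, g p v w = g p w v
  pos : ∀ p v, v ≠ 0 → 0 < g p v v
  smooth : ∀ p, SmoothFieldAt g p

/-- The Ricci tensor. A tangent vector at `p` is represented in Mathlib by its coordinates in the
preferred chart at `p`, so the form at `p` is given by the component matrix in that chart. -/
def ricci (g : BilinField d M) : BilinField d M :=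
  fun p => Matrix.toBilin (EuclideanSpace.basisFun (Fin d) ℝ).toBasis
    (ricciCoord (comps g p) (extChartAt (𝓡 d) p p))

/-- The trace of a bilinear form `S` on `T_p M` with respect to the form `h`. -/
def traceWith {p : M} (h S : LinearMap.BilinForm ℝ (TangentSpace (𝓡 d) p)) : ℝ :=
  let b : Module.Basis (Fin d) ℝ (E d) := (EuclideanSpace.basisFun (Fin d) ℝ).toBasis
  ((LinearMap.BilinForm.toMatrix b h)⁻¹ * LinearMap.BilinForm.toMatrix b S).trace

/-- `μ` is the Riemannian volume measure `√(det g) dy` of `g`. -/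
def IsVolume [MeasurableSpace M] (g : BilinField d M) (μ : MeasureTheory.Measure M) : Prop :=
  ∀ (p : M) (s : Set M), MeasurableSet s → s ⊆ (extChartAt (𝓡 d) p).source →
    μ s = ∫⁻ y in extChartAt (𝓡 d) p '' s, ENNReal.ofReal (Real.sqrt (comps g p y).det)

end Metrics

/-! ## Natural polydifferential operators -/

/-- The combinatorial type of a complete contraction of
`∇^{N_1} Rm ⊗ ⋯ ⊗ ∇^{N_k} Rm ⊗ ∇^{N_{k+1}} u_1 ⊗ ⋯ ⊗ ∇^{N_{k+ℓ}} u_ℓ`: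
the orders of differentiation, and a way to arrange all tensor slots into pairs. -/
structure Contraction (ℓ : ℕ) where
  numCurv : ℕ
  curvOrder : Fin numCurv → ℕ
  funOrder : Fin ℓ → ℕ
  numPairs : ℕ
  pairing : ((Σ c : Fin numCurv, Fin (4 + curvOrder c)) ⊕ (Σ j : Fin ℓ, Fin (0 + funOrder j)))
    ≃ Fin numPairs × Fin 2

/-- The value of a complete contraction at the point with coordinates `y`, for the metric with
components `G` and the functions `u`: each pair of slots is contracted with the inverse metric. -/
def Contraction.value {ℓ d : ℕ} (C : Contraction ℓ) (G : E d → Matrix (Fin d) (Fin d) ℝ)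
    (u : Fin ℓ → E d → ℝ) (y : E d) : ℝ :=
  ∑ a : Fin C.numPairs × Fin 2 → Fin d,
    (∏ q, (G y)⁻¹ (a (q, 0)) (a (q, 1))) *
    (∏ c, iterCovDeriv G (riemann G) (C.curvOrder c) y
      (fun s => a (C.pairing (Sum.inl ⟨c, s⟩)))) *
    (∏ j, iterCovDeriv (m := 0) G (fun z _ => u j z) (C.funOrder j) y
      (fun s => a (C.pairing (Sum.inr ⟨j, s⟩))))

/-- A natural polydifferential operator with `ℓ` arguments (that is, of rank `ℓ + 1`): a universal
real linear combination of complete contractions. -/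
structure NatOp (ℓ : ℕ) where
  terms : List (ℝ × Contraction ℓ)

/-- The operator `D^g` on the manifold `M` with (pseudo-Riemannian) metric `g`, applied to
`u_1 ⊗ ⋯ ⊗ u_ℓ` and evaluated at a point; it is computed in the preferred chart at that point. -/
def NatOp.eval {ℓ d : ℕ} {M : Type} [TopologicalSpace M] [ChartedSpace (E d) M]
    (D : NatOp ℓ) (g : BilinField d M) (u : Fin ℓ → M → ℝ) (p : M) : ℝ :=
  (D.terms.map fun t => t.1 * t.2.value (comps g p)
    (fun j => u j ∘ (extChartAt (𝓡 d) p).symm) (extChartAt (𝓡 d) p p)).sum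

/-- The commutator `[T, f]_j` of an operator on tuples of functions with the multiplication by `f`
in the `j`-th argument. -/
def slotCommutator {ℓ : ℕ} {M : Type} (T : (Fin ℓ → M → ℝ) → M → ℝ) (f : M → ℝ) (j : Fin ℓ)
    (u : Fin ℓ → M → ℝ) (p : M) : ℝ :=
  T (Function.update u j (fun q => f q * u j q)) p - f p * T u p

/-- The pure tensor `u ⊗ v^{⊗ (r - 2)}`, a tuple of `r - 1` functions. -/
def headTail {r : ℕ} {M : Type} (u v : M → ℝ) : Fin (r - 1) → M → ℝ :=
  fun j => if (j : ℕ) = 0 then u else v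

/-- The Dirichlet form of `D` is symmetric on every Riemannian `n`-manifold. -/
def NatOp.IsFormallySelfAdjoint {ℓ : ℕ} (D : NatOp ℓ) (n : ℕ) : Prop :=
  ∀ (M : Type) [TopologicalSpace M] [ChartedSpace (E n) M] [IsManifold (𝓡 n) ∞ M]
    [T2Space M] [SecondCountableTopology M] [MeasurableSpace M] [BorelSpace M]
    (g : BilinField n M) (μ : MeasureTheory.Measure M), IsRiemannian g → IsVolume g μ →
    ∀ u : Fin (ℓ + 1) → M → ℝ,
      (∀ j, ContMDiff (𝓡 n) 𝓘(ℝ, ℝ) ∞ (u j)) → (∀ j, HasCompactSupport (u j)) →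
      ∀ σ : Equiv.Perm (Fin (ℓ + 1)),
        ∫ p, u (σ 0) p * D.eval g (fun j => u (σ j.succ)) p ∂μ
          = ∫ p, u 0 p * D.eval g (fun j => u j.succ) p ∂μ

/-- There are weights `a_1, …, a_ℓ, b` such that, if `g' = e^{2Υ} g`, then
`D^{g'}(u_1 ⊗ ⋯ ⊗ u_ℓ) = e^{bΥ} D^g(e^{-a_1 Υ} u_1 ⊗ ⋯ ⊗ e^{-a_ℓ Υ} u_ℓ)`. -/
def NatOp.IsConformallyCovariant {ℓ : ℕ} (D : NatOp ℓ) (n : ℕ) : Prop :=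
  ∃ (a : Fin ℓ → ℝ) (b : ℝ),
    ∀ (M : Type) [TopologicalSpace M] [ChartedSpace (E n) M] [IsManifold (𝓡 n) ∞ M]
      [T2Space M] [SecondCountableTopology M] (g g' : BilinField n M) (Υ : M → ℝ),
      IsRiemannian g → IsRiemannian g' → ContMDiff (𝓡 n) 𝓘(ℝ, ℝ) ∞ Υ →
      (∀ p, g' p = Real.exp (2 * Υ p) • g p) →
      ∀ u : Fin ℓ → M → ℝ, (∀ j, ContMDiff (𝓡 n) 𝓘(ℝ, ℝ) ∞ (u j)) →
        ∀ p, D.eval g' u p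
          = Real.exp (b * Υ p) * D.eval g (fun j q => Real.exp (-a j * Υ q) * u j q) p

/-- `D^{c² g} = c^h D^g` for every Riemannian `n`-manifold and every constant `c > 0`. -/
def NatOp.HasHomogeneity {ℓ : ℕ} (D : NatOp ℓ) (n : ℕ) (h : ℝ) : Prop :=
  ∀ (M : Type) [TopologicalSpace M] [ChartedSpace (E n) M] [IsManifold (𝓡 n) ∞ M]
    [T2Space M] [SecondCountableTopology M] (g : BilinField n M), IsRiemannian g →
    ∀ c : ℝ, 0 < c → ∀ u : Fin ℓ → M → ℝ, (∀ j, ContMDiff (𝓡 n) 𝓘(ℝ, ℝ) ∞ (u j)) →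
      ∀ p, D.eval (fun q => c ^ 2 • g q) u p = c ^ h * D.eval g u p

/-! ## Ambient spaces

Let `(M, 𝔠)` be a conformal `n`-manifold. A metric `g` in `𝔠` trivialises the bundle `𝒢` of metrics
in `𝔠`: the triple `(x, s, ρ)` with `s > 0` stands for the point `((x, s² g_x), ρ)` of `𝒢 × ℝ`. -/

/-- The model with corners of `M × ℝ × ℝ`. -/
abbrev model𝒢 (n : ℕ) := (𝓡 n).prod (𝓘(ℝ, ℝ).prod 𝓘(ℝ, ℝ))

/-- A subset `dom` of `𝒢 × ℝ`, and a map from it to a manifold `Y` of dimension `n + 2`. -/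
structure AmbientData (n : ℕ) (M Y : Type) where
  dom : Set (M × ℝ × ℝ)
  coord : M × ℝ × ℝ → Y

namespace AmbientData

variable {n : ℕ} {M Y : Type} (A : AmbientData n M Y)

/-- The part of `Y` that is identified with `dom`. -/
def carrier : Set Y := A.coord '' A.dom

/-- The inclusion `ι : 𝒢 → 𝒢 × {0}`, for `x : M` and `s > 0`. -/
def ι (x : M) (s : ℝ) : Y := A.coord (x, s, 0)

variable [TopologicalSpace M] [ChartedSpace (E n) M]
  [TopologicalSpace Y] [ChartedSpace (E (n + 2)) Y]

/-- `Y` carries, by way of the coordinates, a dilation-invariant open subset of `𝒢 × ℝ` that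
contains `𝒢 × {0}`; `coord` is a diffeomorphism of `dom` onto the open set `carrier`. -/
structure IsIdentification : Prop where
  isOpen_dom : IsOpen A.dom
  pos : ∀ q ∈ A.dom, 0 < q.2.1
  dilate : ∀ (x : M) (t ρ s : ℝ), 0 < s → (x, t, ρ) ∈ A.dom → (x, s * t, ρ) ∈ A.dom
  zero_section : ∀ (x : M) (t : ℝ), 0 < t → (x, t, 0) ∈ A.dom
  injOn : Set.InjOn A.coord A.dom
  localDiffeo : IsLocalDiffeomorphOn (model𝒢 n) (𝓡 (n + 2)) ∞ A.coord A.dom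

/-- The pullback to `M × ℝ × ℝ` of a field of bilinear forms on `Y`. -/
def pull (T : BilinField (n + 2) Y) (q : M × ℝ × ℝ) (v w : E n × ℝ × ℝ) : ℝ :=
  T (A.coord q) (mfderiv (model𝒢 n) (𝓡 (n + 2)) A.coord q v)
    (mfderiv (model𝒢 n) (𝓡 (n + 2)) A.coord q w)

/-- `T = O(ρ^m)`: all derivatives of order less than `m` of the components of `T` vanish along
`𝒢 × {0}`. -/
def IsO (m : ℕ) (T : BilinField (n + 2) Y) : Prop :=
  ∀ (x : M) (t : ℝ), 0 < t → ∀ i j, ∀ N < m,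
    iteratedFDeriv ℝ N (fun y => comps T (A.ι x t) y i j)
      (extChartAt (𝓡 (n + 2)) (A.ι x t) (A.ι x t)) = 0

/-- `T = O⁺(ρ^m)`: `T = O(ρ^m)`, and at each point over `x` of `𝒢` the form `ι^*(ρ^{-m} T)` is the
pullback of a symmetric trace-free form `S` on `T_x M`. -/
def IsOPlus (g : BilinField n M) (m : ℕ) (T : BilinField (n + 2) Y) : Prop :=
  A.IsO m T ∧
  ∀ (x : M) (t : ℝ), 0 < t →
    ∃ S : LinearMap.BilinForm ℝ (TangentSpace (𝓡 n) x),
      (∀ v w, S v w = S w v) ∧ traceWith (g x) S = 0 ∧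
      ∀ (v w : E n) (α β : ℝ),
        Filter.Tendsto (fun ρ : ℝ => (ρ ^ m)⁻¹ * A.pull T (x, t, ρ) (v, α, 0) (w, β, 0))
          (nhdsWithin 0 {0}ᶜ) (nhds (S v w))

/-- `(carrier, gt)` is a pre-ambient space for `(M, [g])`: `gt` is a pseudo-Riemannian metric that
is homogeneous of degree `2` with respect to the dilations `(x, t, ρ) ↦ (x, s t, ρ)`, and `ι^* gt`
is the tautological tensor of `𝒢`. -/
structure IsPreAmbient (g : BilinField n M) (gt : BilinField (n + 2) Y) : Prop
    extends A.IsIdentification where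
  pseudoRiemannian : IsPseudoRiemannianOn gt A.carrier
  homogeneous : ∀ (x : M) (t ρ s : ℝ), 0 < s → (x, t, ρ) ∈ A.dom →
    ∀ (v w : E n) (α β γ δ : ℝ),
      A.pull gt (x, s * t, ρ) (v, s * α, γ) (w, s * β, δ)
        = s ^ 2 * A.pull gt (x, t, ρ) (v, α, γ) (w, β, δ)
  tautological : ∀ (x : M) (t : ℝ), 0 < t → ∀ (v w : E n) (α β : ℝ),
    A.pull gt (x, t, 0) (v, α, 0) (w, β, 0) = t ^ 2 * g x v w

/-- `(carrier, gt)` is an ambient space for `(M, [g])`. -/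
structure IsAmbient (g : BilinField n M) (gt : BilinField (n + 2) Y) : Prop
    extends A.IsPreAmbient g gt where
  ricci_odd : n = 2 ∨ Odd n → ∀ m, A.IsO m (ricci gt)
  ricci_even : 4 ≤ n → Even n → A.IsOPlus g (n / 2 - 1) (ricci gt)

/-- `f ∈ ℰ̃[w]`: `f` is smooth on the ambient space and homogeneous of weight `w`. -/
def IsHomogeneous (w : ℝ) (f : Y → ℝ) : Prop :=
  ContMDiffOn (𝓡 (n + 2)) 𝓘(ℝ, ℝ) ∞ f A.carrier ∧
  ∀ (x : M) (t ρ s : ℝ), 0 < s → (x, t, ρ) ∈ A.dom →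
    f (A.coord (x, s * t, ρ)) = s ^ w * f (A.coord (x, t, ρ))

end AmbientData

/-- `Dt` is an operator `ℰ̃[a_1] ⊗ ⋯ ⊗ ℰ̃[a_ℓ] → ℰ̃[b]` on the ambient spaces of conformal
`n`-manifolds which is tangential and which induces `D`. -/
structure NatOp.DefinesHolographically {ℓ : ℕ} (Dt D : NatOp ℓ) (n : ℕ)
    (a : Fin ℓ → ℝ) (b : ℝ) : Prop where
  /-- `Dt` maps homogeneous functions to homogeneous functions. -/
  maps : ∀ (M Y : Type) [TopologicalSpace M] [ChartedSpace (E n) M] [IsManifold (𝓡 n) ∞ M]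
    [T2Space M] [SecondCountableTopology M]
    [TopologicalSpace Y] [ChartedSpace (E (n + 2)) Y] [IsManifold (𝓡 (n + 2)) ∞ Y]
    [T2Space Y] [SecondCountableTopology Y]
    (A : AmbientData n M Y) (g : BilinField n M) (gt : BilinField (n + 2) Y),
    IsRiemannian g → A.IsAmbient g gt →
    ∀ f : Fin ℓ → Y → ℝ, (∀ j, A.IsHomogeneous (a j) (f j)) → A.IsHomogeneous b (Dt.eval gt f)
  /-- The restriction of `Dt(f_1 ⊗ ⋯ ⊗ f_ℓ)` to `𝒢` depends only on the restrictions of the `f_j`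
  and on the ambient metric (modulo `O⁺(ρ^{n/2})`, if `n` is even). -/
  tangential : ∀ (M Y : Type) [TopologicalSpace M] [ChartedSpace (E n) M]
    [IsManifold (𝓡 n) ∞ M] [T2Space M] [SecondCountableTopology M]
    [TopologicalSpace Y] [ChartedSpace (E (n + 2)) Y] [IsManifold (𝓡 (n + 2)) ∞ Y]
    [T2Space Y] [SecondCountableTopology Y]
    (A : AmbientData n M Y) (g : BilinField n M) (gt gt' : BilinField (n + 2) Y),
    IsRiemannian g → A.IsAmbient g gt → A.IsAmbient g gt' →
    (Odd n → ∀ p ∈ A.carrier, gt p = gt' p) →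
    (Even n → A.IsOPlus g (n / 2) (fun p => gt p - gt' p)) →
    ∀ f f' : Fin ℓ → Y → ℝ,
      (∀ j, A.IsHomogeneous (a j) (f j)) → (∀ j, A.IsHomogeneous (a j) (f' j)) →
      (∀ j (x : M) (s : ℝ), 0 < s → f j (A.ι x s) = f' j (A.ι x s)) →
      ∀ (x : M) (s : ℝ), 0 < s → Dt.eval gt f (A.ι x s) = Dt.eval gt' f' (A.ι x s)
  /-- `D^g(u_1 ⊗ ⋯ ⊗ u_ℓ)` is the restriction to `(M, g)` of `Dt(f_1 ⊗ ⋯ ⊗ f_ℓ)`, whenever the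
  `f_j` are homogeneous extensions of the `u_j`. -/
  induces : ∀ (M Y : Type) [TopologicalSpace M] [ChartedSpace (E n) M] [IsManifold (𝓡 n) ∞ M]
    [T2Space M] [SecondCountableTopology M]
    [TopologicalSpace Y] [ChartedSpace (E (n + 2)) Y] [IsManifold (𝓡 (n + 2)) ∞ Y]
    [T2Space Y] [SecondCountableTopology Y]
    (A : AmbientData n M Y) (g : BilinField n M) (gt : BilinField (n + 2) Y),
    IsRiemannian g → A.IsAmbient g gt →
    ∀ (u : Fin ℓ → M → ℝ) (f : Fin ℓ → Y → ℝ),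
      (∀ j, ContMDiff (𝓡 n) 𝓘(ℝ, ℝ) ∞ (u j)) → (∀ j, A.IsHomogeneous (a j) (f j)) →
      (∀ j x, f j (A.ι x 1) = u j x) →
      ∀ x, D.eval g u x = Dt.eval gt f (A.ι x 1)

/-! ## The round sphere and its flat ambient space -/

/-- The unit sphere `S^n` in `ℝ^{n+1}`. -/
abbrev Sph (n : ℕ) := Metric.sphere (0 : E (n + 1)) 1

/-- The round metric `dθ²`, induced by the inclusion of `S^n` into `ℝ^{n+1}`. -/
def roundMetric (n : ℕ) : BilinField n (Sph n) := fun x =>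
  let dι : TangentSpace (𝓡 n) x →ₗ[ℝ] E (n + 1) :=
    (mfderiv (𝓡 n) (𝓡 (n + 1)) (fun y : Sph n => (y : E (n + 1))) x).toLinearMap
  (innerₗ (E (n + 1))).compl₁₂ dι dι

/-- The Cartesian coordinate `x^i` on `S^n`. -/
def xS {n : ℕ} (i : Fin (n + 1)) (x : Sph n) : ℝ := (x : E (n + 1)) i

/-- The coordinate `t̃` of `ℝ × ℝ^{n+1}`. -/
def tM {n : ℕ} (p : E (n + 2)) : ℝ := p 0

/-- The coordinate `x̃^i` of `ℝ × ℝ^{n+1}`. -/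
def xM {n : ℕ} (i : Fin (n + 1)) (p : E (n + 2)) : ℝ := p i.succ

/-- The Minkowski metric `-dt̃² + ∑ (dx̃^i)²`. -/
def minkowski (n : ℕ) : BilinField (n + 2) (E (n + 2)) := fun _ =>
  Matrix.toBilin (EuclideanSpace.basisFun (Fin (n + 2)) ℝ).toBasis
    (Matrix.diagonal (Fin.cons (-1) fun _ => 1))

/-- The point `(s, s x)` of the future light cone; it stands for `(x, s² dθ²_x) ∈ 𝒢`. -/
def conePoint {n : ℕ} (x : Sph n) (s : ℝ) : E (n + 2) :=
  WithLp.toLp 2 (Fin.cons s fun i => s * (x : E (n + 1)) i)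

/-- `U` is a dilation-invariant open neighbourhood of the future light cone. -/
structure IsFlatAmbientDomain {n : ℕ} (U : Set (E (n + 2))) : Prop where
  isOpen : IsOpen U
  dilate : ∀ p ∈ U, ∀ s : ℝ, 0 < s → s • p ∈ U
  cone : ∀ (x : Sph n) (s : ℝ), 0 < s → conePoint x s ∈ U

/-- `f ∈ ℰ̃[w]` is a homogeneous extension of the function `u` on `(S^n, dθ²)` to the flat ambient
space `U`. -/
structure IsFlatExtension {n : ℕ} (U : Set (E (n + 2))) (w : ℝ) (u : Sph n → ℝ)
    (f : E (n + 2) → ℝ) : Prop where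
  smooth : ContDiffOn ℝ ∞ f U
  homogeneous : ∀ p ∈ U, ∀ s : ℝ, 0 < s → f (s • p) = s ^ w * f p
  restrict : ∀ x, f (conePoint x 1) = u x

end Ambient

end

open Ambient
open scoped Manifold ContDiff

namespace Ambient

/-! ## Flat metrics -/

/-! The identity holds separately for each `i`. Multiplying `ut`, whose weight is one too low, by a
linear coordinate raises its weight by one, so `tM * ut` and `xM i * ut` are admissible first
arguments of `Dt`. On the section `t̃ = 1`, `|x̃| = 1` of the cone they restrict to `u` and to `x^i
u`. Since `Dt` induces `D`, the two ambient terms are therefore `D(x^i u ⊗ v ⊗ ⋯)` and `D(u ⊗ v ⊗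
⋯)` on the round sphere, with factors `x^i` and `(x^i)²`. Their difference is `x^i [D, x^i]_1`.

What needs work is that `minkowski` near the light cone is an ambient metric of the round sphere
(`isAmbient_flatAmbient`). The polar coordinates `(x, s, ρ) ↦ (s, s (1 + ρ) x)` identify a
neighbourhood of the cone with part of `𝒢 × ℝ` (`coneDiffeo`). Homogeneity and the tautological
restriction are read off an explicit formula for the pulled-back metric (`pull_minkowski`), and the
Ricci conditions hold because a metric with constant components is flat (`ricci_minkowski`). Then
`eval_headTail` transfers values of `D` on the sphere to values of `Dt` on the cone. -/

theorem partialD_const {d : ℕ} (i : Fin d) (c : ℝ) (y : E d) :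
    partialD i (fun _ => c) y = 0 := by
  simp [partialD]

theorem christoffel_const {d : ℕ} (G : Matrix (Fin d) (Fin d) ℝ) (l i j : Fin d) :
    christoffel (fun _ => G) l i j = fun _ => 0 := by
  funext y
  simp [christoffel, partialD_const]

theorem ricciCoord_const {d : ℕ} (G : Matrix (Fin d) (Fin d) ℝ) (y : E d) :
    ricciCoord (fun _ => G) y = 0 := by
  ext j k
  simp [ricciCoord, riemannUp, christoffel_const, partialD_const]

/-- In a vector space, the components of a field of bilinear forms in the preferred chart are its
components with respect to the standard basis. -/
theorem comps_vectorSpace {d : ℕ} (T : BilinField d (E d)) (p y : E d) (i j : Fin d) :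
    comps T p y i j = T y (EuclideanSpace.single i (1 : ℝ)) (EuclideanSpace.single j (1 : ℝ)) := by
  have h : mfderiv (𝓡 d) (𝓡 d) (extChartAt (𝓡 d) p).symm y = ContinuousLinearMap.id ℝ (E d) := by
    simp only [mfld_simps]
    exact mfderiv_id
  simp only [comps, h]
  simp only [mfld_simps]
  rfl

theorem comps_minkowski (n : ℕ) (p y : E (n + 2)) :
    comps (minkowski n) p y = Matrix.diagonal (Fin.cons (-1) fun _ => 1) := by
  ext i j
  rw [comps_vectorSpace]
  have h := LinearMap.BilinForm.toMatrix_toBilin (EuclideanSpace.basisFun (Fin (n + 2)) ℝ).toBasis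
    (Matrix.diagonal (Fin.cons (-1) fun _ => (1 : ℝ)))
  have hij := congrFun (congrFun h i) j
  rw [LinearMap.BilinForm.toMatrix_apply] at hij
  simp only [OrthonormalBasis.coe_toBasis, EuclideanSpace.basisFun_apply] at hij
  exact hij

theorem ricci_minkowski (n : ℕ) : ricci (minkowski n) = fun _ => 0 := by
  funext p
  have h : comps (minkowski n) p = fun _ => Matrix.diagonal (Fin.cons (-1) fun _ => 1) :=
    funext (comps_minkowski n p)
  simp only [ricci, h, ricciCoord_const]
  exact map_zero _

/-- The splitting `ℝ^{n+2} = ℝ × ℝ^{n+1}` into time and space. -/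
noncomputable def timeSpace (n : ℕ) : E (n + 2) ≃L[ℝ] ℝ × E (n + 1) :=
  LinearEquiv.toContinuousLinearEquiv
    { toFun := fun p => (p 0, WithLp.toLp 2 fun i => p i.succ)
      invFun := fun q => WithLp.toLp 2 (Fin.cons q.1 fun i => q.2 i)
      map_add' := fun p q => rfl
      map_smul' := fun c p => rfl
      left_inv := fun p => by
        ext i
        refine Fin.cases ?_ (fun i => ?_) i <;> simp
      right_inv := fun q => by
        ext <;> simp }

theorem timeSpace_apply (n : ℕ) (p : E (n + 2)) :
    timeSpace n p = (p 0, WithLp.toLp 2 fun i => p i.succ) := rfl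

theorem timeSpace_symm_apply (n : ℕ) (q : ℝ × E (n + 1)) :
    (timeSpace n).symm q = WithLp.toLp 2 (Fin.cons q.1 fun i => q.2 i) := rfl

/-- The spatial part is kept as an inner product on `E (n + 1)`, so that it can be compared with the
round metric, which is induced from the same inner product. -/
theorem minkowski_apply (n : ℕ) (p : E (n + 2)) (v w : E (n + 2)) :
    minkowski n p v w = -(v 0 * w 0)
      + inner ℝ (timeSpace n v).2 (timeSpace n w).2 := by
  have h := Matrix.toBilin_apply (EuclideanSpace.basisFun (Fin (n + 2)) ℝ).toBasis
    (Matrix.diagonal (Fin.cons (-1) fun _ => (1 : ℝ))) v w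
  refine h.trans ?_
  simp [Matrix.diagonal_apply, Fin.sum_univ_succ, timeSpace_apply, PiLp.inner_apply, mul_comm]

theorem isPseudoRiemannianOn_minkowski (n : ℕ) (U : Set (E (n + 2))) :
    IsPseudoRiemannianOn (minkowski n) U where
  symm p _ v w := by
    rw [minkowski_apply n p v w, minkowski_apply n p w v, mul_comm (v.ofLp 0), real_inner_comm]
  nondegenerate p _ (v : E (n + 2)) hv := by
    have h : ∀ w : E (n + 2), _ := fun w => (minkowski_apply n p v w).symm.trans (hv w)
    -- Pairing a vector with its time reflection turns the Lorentzian form into the sum of squares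
    -- of the time and space parts, which vanishes only at zero.
    have h0 := h ((timeSpace n).symm (-(timeSpace n v).1, (timeSpace n v).2))
    rw [ContinuousLinearEquiv.apply_symm_apply] at h0
    simp only [timeSpace_symm_apply, Fin.cons_zero, real_inner_self_eq_norm_sq] at h0
    have h1 : v 0 = (timeSpace n v).1 := rfl
    rw [h1] at h0
    refine (timeSpace n).map_eq_zero_iff.1 (Prod.ext ?_ (norm_eq_zero.1 ?_))
    · change (timeSpace n v).1 = 0
      nlinarith [sq_nonneg (timeSpace n v).1, sq_nonneg ‖(timeSpace n v).2‖]
    · nlinarith [sq_nonneg (timeSpace n v).1, sq_nonneg ‖(timeSpace n v).2‖]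
  smooth p _ i j := by
    simp only [comps_minkowski]
    exact contDiffAt_const

theorem comps_zero {d : ℕ} {M : Type} [TopologicalSpace M] [ChartedSpace (E d) M] (p : M)
    (y : E d) (i j : Fin d) : comps (fun _ => 0 : BilinField d M) p y i j = 0 := rfl

theorem AmbientData.isO_zero {n : ℕ} {M Y : Type} [TopologicalSpace M] [ChartedSpace (E n) M]
    [TopologicalSpace Y] [ChartedSpace (E (n + 2)) Y] (A : AmbientData n M Y) (m : ℕ) :
    A.IsO m (fun _ => 0) := by
  intro x t _ i j N _
  simp only [comps_zero]
  simp

theorem AmbientData.isOPlus_zero {n : ℕ} {M Y : Type} [TopologicalSpace M] [ChartedSpace (E n) M]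
    [TopologicalSpace Y] [ChartedSpace (E (n + 2)) Y] (A : AmbientData n M Y) (g : BilinField n M)
    (m : ℕ) : A.IsOPlus g m (fun _ => 0) := by
  refine ⟨A.isO_zero m, fun x t _ => ⟨0, fun _ _ => rfl, ?_, fun v w α β => ?_⟩⟩
  · simp only [traceWith]
    erw [map_zero]
    simp
  · have h : ∀ ρ : ℝ, A.pull (fun _ => 0) (x, t, ρ) (v, α, 0) (w, β, 0) = 0 := fun _ => rfl
    simp only [h, mul_zero]
    exact tendsto_const_nhds

/-! ## The round sphere -/

theorem contMDiff_coe_sph (n : ℕ) {m : ℕ∞ω} :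
    ContMDiff (𝓡 n) (𝓡 (n + 1)) m (fun x : Sph n => (x : E (n + 1))) :=
  have := Fact.mk (@finrank_euclideanSpace_fin ℝ _ (n + 1))
  contMDiff_coe_sphere

/-- The differential of the inclusion of the sphere. -/
noncomputable def dcoe {n : ℕ} (x : Sph n) : E n →L[ℝ] E (n + 1) :=
  mfderiv (𝓡 n) (𝓡 (n + 1)) (fun y : Sph n => (y : E (n + 1))) x

theorem hasMFDerivAt_coe {n : ℕ} (x : Sph n) :
    HasMFDerivAt (𝓡 n) (𝓡 (n + 1)) (fun y : Sph n => (y : E (n + 1))) x (dcoe x) :=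
  ((contMDiff_coe_sph n x).mdifferentiableAt (n := 1) one_ne_zero).hasMFDerivAt

theorem roundMetric_apply {n : ℕ} (x : Sph n) (v w : E n) :
    roundMetric n x v w = inner ℝ (dcoe x v) (dcoe x w) := rfl

theorem dcoe_injective {n : ℕ} (x : Sph n) : Function.Injective (dcoe x) :=
  have := Fact.mk (@finrank_euclideanSpace_fin ℝ _ (n + 1))
  injective_mvfderiv_subtypeVal_sphere x

/-- The tangent space of the sphere at `x` is the orthogonal complement of `x`. This removes the
cross terms between radial and tangential directions in `pull_minkowski`. -/
theorem inner_coe_dcoe {n : ℕ} (x : Sph n) (v : E n) : inner ℝ (x : E (n + 1)) (dcoe x v) = 0 := by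
  have := Fact.mk (@finrank_euclideanSpace_fin ℝ _ (n + 1))
  have h : dcoe x v ∈ (ℝ ∙ (x : E (n + 1)))ᗮ := by
    rw [← range_mvfderiv_subtypeVal (n := n) x]
    exact ⟨v, rfl⟩
  exact Submodule.mem_orthogonal_singleton_iff_inner_right.1 h

/-- By the chain rule, the inclusion read in a chart has ordinary Fréchet derivative equal to the
composite of the two manifold derivatives. Smoothness of the metric then reduces to that of a map
between vector spaces. The inverse chart is controlled only on the chart target, hence `hy`. -/
theorem comps_roundMetric {n : ℕ} (p : Sph n) {y : E n} (hy : y ∈ (extChartAt (𝓡 n) p).target)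
    (i j : Fin n) :
    comps (roundMetric n) p y i j =
      inner ℝ (fderiv ℝ (fun z => ((extChartAt (𝓡 n) p).symm z : E (n + 1))) y
          (EuclideanSpace.single i 1))
        (fderiv ℝ (fun z => ((extChartAt (𝓡 n) p).symm z : E (n + 1))) y
          (EuclideanSpace.single j 1)) := by
  have h1 : MDifferentiableAt (𝓡 n) (𝓡 n) (extChartAt (𝓡 n) p).symm y :=
    (mdifferentiableOn_extChartAt_symm y hy).mdifferentiableAt
      ((isOpen_extChartAt_target p).mem_nhds hy)
  have h2 := ((hasMFDerivAt_coe ((extChartAt (𝓡 n) p).symm y)).comp y h1.hasMFDerivAt)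
  have h3 : fderiv ℝ (fun z => ((extChartAt (𝓡 n) p).symm z : E (n + 1))) y = _ :=
    mfderiv_eq_fderiv.symm.trans h2.mfderiv
  rw [h3]
  rfl

theorem isRiemannian_roundMetric (n : ℕ) : IsRiemannian (roundMetric n) where
  symm p v w := real_inner_comm (dcoe p w) (dcoe p v)
  pos p v hv := by
    change 0 < inner ℝ (dcoe p v) (dcoe p v)
    exact real_inner_self_pos.2 fun h => hv (dcoe_injective p (h.trans (map_zero _).symm))
  smooth p i j := by
    have hmem := extChartAt_target_mem_nhds (I := 𝓡 n) p
    have h1 : ContDiffOn ℝ ∞ (fun z => ((extChartAt (𝓡 n) p).symm z : E (n + 1)))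
        (extChartAt (𝓡 n) p).target :=
      ((contMDiff_coe_sph n).comp_contMDiffOn (contMDiffOn_extChartAt_symm p)).contDiffOn
    have h2 := h1.contDiffAt hmem
    have h3 : ContDiffAt ℝ ∞ (fderiv ℝ fun z => ((extChartAt (𝓡 n) p).symm z : E (n + 1)))
        (extChartAt (𝓡 n) p p) := h2.fderiv_right (by norm_num)
    have h4 (k : Fin n) : ContDiffAt ℝ ∞ (fun y =>
        fderiv ℝ (fun z => ((extChartAt (𝓡 n) p).symm z : E (n + 1))) y
          (EuclideanSpace.single k 1)) (extChartAt (𝓡 n) p p) :=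
      h3.clm_apply contDiffAt_const
    refine ((h4 i).inner ℝ (h4 j)).congr_of_eventuallyEq ?_
    exact Filter.eventually_of_mem hmem fun y hy => comps_roundMetric p hy i j

end Ambient

/-! ### Polar coordinates around the light cone. -/

namespace Ambient

/-- The radial projection onto the sphere; its value at the origin is irrelevant. -/
noncomputable def radial (n : ℕ) (y : E (n + 1)) : Sph n :=
  if h : y = 0 then ⟨EuclideanSpace.single 0 1, by simp⟩ else ⟨‖y‖⁻¹ • y, by simp [norm_smul, h]⟩

theorem coe_radial {n : ℕ} {y : E (n + 1)} (hy : y ≠ 0) :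
    (radial n y : E (n + 1)) = ‖y‖⁻¹ • y := by
  simp [radial, hy]

theorem radial_smul {n : ℕ} (x : Sph n) {c : ℝ} (hc : 0 < c) :
    radial n (c • (x : E (n + 1))) = x := by
  have hx : ‖(x : E (n + 1))‖ = 1 := by simp
  have hne : c • (x : E (n + 1)) ≠ 0 := by
    rw [← norm_pos_iff, norm_smul, hx, mul_one]
    exact norm_pos_iff.2 hc.ne'
  apply Subtype.ext
  rw [coe_radial hne, norm_smul, hx, mul_one, Real.norm_of_nonneg hc.le, inv_smul_smul₀ hc.ne']

theorem contMDiffOn_radial (n : ℕ) :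
    ContMDiffOn (𝓡 (n + 1)) (𝓡 n) ∞ (radial n) {y | y ≠ 0} := by
  have := Fact.mk (@finrank_euclideanSpace_fin ℝ _ (n + 1))
  -- Corestriction to the sphere needs a map that has unit norm everywhere, so the punctured space
  -- is treated as a manifold of its own.
  let V : TopologicalSpace.Opens (E (n + 1)) := ⟨{y | y ≠ 0}, isOpen_ne⟩
  have h1 : ContMDiff (𝓡 (n + 1)) (𝓡 (n + 1)) ∞
      (fun y : V => ‖(y : E (n + 1))‖⁻¹ • (y : E (n + 1))) := by
    intro y
    have h : ContDiffAt ℝ ∞ (fun y : E (n + 1) => ‖y‖⁻¹ • y) y :=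
      ((contDiffAt_norm ℝ y.2).inv (norm_ne_zero_iff.2 y.2)).smul contDiffAt_id
    exact contMDiffAt_subtype_iff.2 h.contMDiffAt
  have h2 : ContMDiff (𝓡 (n + 1)) (𝓡 n) ∞ (fun y : V => radial n y) := by
    have h := h1.codRestrict_sphere (n := n) (fun y => by
      simp [norm_smul, show (y : E (n + 1)) ≠ 0 from y.2])
    refine h.congr fun y => ?_
    exact Subtype.ext (coe_radial y.2)
  intro y hy
  exact (contMDiffAt_subtype_iff.1 (h2 ⟨y, hy⟩)).contMDiffWithinAt

/-- The coordinates `(x, s, ρ) ↦ (s, s (1 + ρ) x)` near the light cone. -/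
noncomputable def coneCoord (n : ℕ) (q : Sph n × ℝ × ℝ) : E (n + 2) :=
  (timeSpace n).symm (q.2.1, (q.2.1 * (1 + q.2.2)) • (q.1 : E (n + 1)))

theorem timeSpace_coneCoord {n : ℕ} (q : Sph n × ℝ × ℝ) :
    timeSpace n (coneCoord n q) = (q.2.1, (q.2.1 * (1 + q.2.2)) • (q.1 : E (n + 1))) :=
  (timeSpace n).apply_symm_apply _

theorem coneCoord_zero {n : ℕ} (x : Sph n) (s : ℝ) : coneCoord n (x, s, 0) = conePoint x s := by
  simp [coneCoord, conePoint, timeSpace_symm_apply]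

theorem coneCoord_mul {n : ℕ} (x : Sph n) (t ρ s : ℝ) :
    coneCoord n (x, s * t, ρ) = s • coneCoord n (x, t, ρ) := by
  rw [coneCoord, coneCoord, ← map_smul]
  simp only [Prod.smul_mk, smul_eq_mul, smul_smul, mul_assoc]

theorem contMDiff_coneCoord (n : ℕ) :
    ContMDiff (model𝒢 n) (𝓡 (n + 2)) ∞ (coneCoord n) := by
  have h1 : ContMDiff (model𝒢 n) 𝓘(ℝ, E (n + 1) × ℝ × ℝ) ∞
      (fun q : Sph n × ℝ × ℝ => ((q.1 : E (n + 1)), q.2.1, q.2.2)) :=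
    ((contMDiff_coe_sph n).comp contMDiff_fst).prodMk_space
      ((contMDiff_fst.comp contMDiff_snd).prodMk_space (contMDiff_snd.comp contMDiff_snd))
  have h2 : ContDiff ℝ ∞ (fun q : E (n + 1) × ℝ × ℝ =>
      (timeSpace n).symm (q.2.1, (q.2.1 * (1 + q.2.2)) • q.1)) := by
    refine (timeSpace n).symm.contDiff.comp ?_
    fun_prop
  exact h2.contMDiff.comp h1

/-- Polar coordinates, as a partial diffeomorphism. -/
noncomputable def coneDiffeo (n : ℕ) :
    PartialDiffeomorph (model𝒢 n) (𝓡 (n + 2)) (Sph n × ℝ × ℝ) (E (n + 2)) ∞ where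
  toFun := coneCoord n
  -- The time part is `s` and the space part has norm `s (1 + ρ)`, so `ρ` is the quotient of norm
  -- and time, minus one. The bounds `s > 0` and `ρ > -1` keep that norm positive.
  invFun p := (radial n (timeSpace n p).2, (timeSpace n p).1,
    ‖(timeSpace n p).2‖ / (timeSpace n p).1 - 1)
  source := {q | 0 < q.2.1 ∧ -1 < q.2.2}
  target := {p | 0 < (timeSpace n p).1 ∧ (timeSpace n p).2 ≠ 0}
  map_source' := by
    rintro ⟨x, s, ρ⟩ ⟨hs, hρ⟩
    simp only [Set.mem_ofPred_eq, timeSpace_coneCoord]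
    have hx : (x : E (n + 1)) ≠ 0 := ne_zero_of_mem_unit_sphere x
    exact ⟨hs, smul_ne_zero (mul_pos hs (by simp only at hρ; linarith)).ne' hx⟩
  map_target' := by
    rintro p ⟨h1, h2⟩
    refine ⟨h1, ?_⟩
    have : 0 < ‖(timeSpace n p).2‖ / (timeSpace n p).1 := div_pos (norm_pos_iff.2 h2) h1
    change -1 < ‖(timeSpace n p).2‖ / (timeSpace n p).1 - 1
    linarith
  left_inv' := by
    rintro ⟨x, s, ρ⟩ ⟨hs, hρ⟩
    simp only at hs hρ
    have hx : ‖(x : E (n + 1))‖ = 1 := by simp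
    have hpos : 0 < s * (1 + ρ) := mul_pos hs (by linarith)
    simp only [timeSpace_coneCoord]
    rw [radial_smul x hpos, norm_smul, hx, Real.norm_of_nonneg hpos.le]
    congr 2
    field_simp
    ring
  right_inv' := by
    rintro p ⟨h1, h2⟩
    apply (timeSpace n).injective
    rw [timeSpace_coneCoord]
    refine Prod.ext rfl ?_
    simp only
    rw [coe_radial h2, smul_smul]
    have h3 := norm_pos_iff.2 h2
    have h4 : (timeSpace n p).1 * (1 + (‖(timeSpace n p).2‖ / (timeSpace n p).1 - 1))
      * ‖(timeSpace n p).2‖⁻¹ = 1 := by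
      field_simp
      ring
    rw [h4, one_smul]
  open_source := (isOpen_lt continuous_const (continuous_fst.comp continuous_snd)).inter
    (isOpen_lt continuous_const (continuous_snd.comp continuous_snd))
  open_target := (isOpen_lt continuous_const (continuous_fst.comp (timeSpace n).continuous)).inter
    (isOpen_ne.preimage (continuous_snd.comp (timeSpace n).continuous))
  contMDiffOn_toFun := (contMDiff_coneCoord n).contMDiffOn
  contMDiffOn_invFun := by
    have hT : ContDiff ℝ ∞ (timeSpace n) := (timeSpace n).contDiff
    have h1 : ContDiff ℝ ∞ fun p => (timeSpace n p).1 := contDiff_fst.comp hT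
    have h2 : ContDiff ℝ ∞ fun p => (timeSpace n p).2 := contDiff_snd.comp hT
    refine ((contMDiffOn_radial n).comp h2.contMDiff.contMDiffOn fun p hp => hp.2).prodMk
      (h1.contMDiff.contMDiffOn.prodMk (ContDiffOn.contMDiffOn ?_))
    intro p hp
    exact ((((h2.contDiffAt.norm ℝ hp.2).div h1.contDiffAt hp.1.ne').sub
      contDiffAt_const)).contDiffWithinAt

/-- The map factors through the inclusion of the sphere in the first factor, followed by a
polynomial map on `E (n + 1) × ℝ × ℝ`, to which the product rule applies. -/
theorem mfderiv_coneCoord {n : ℕ} (q : Sph n × ℝ × ℝ) (v : E n × ℝ × ℝ) :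
    mfderiv (model𝒢 n) (𝓡 (n + 2)) (coneCoord n) q v =
      (timeSpace n).symm (v.2.1, (q.2.1 * (1 + q.2.2)) • dcoe q.1 v.1
        + (v.2.1 * (1 + q.2.2) + q.2.1 * v.2.2) • (q.1 : E (n + 1))) := by
  have hfst : HasMFDerivAt (model𝒢 n) (𝓡 n) (Prod.fst : Sph n × ℝ × ℝ → Sph n) q
    (ContinuousLinearMap.fst ℝ (E n) (ℝ × ℝ)) := hasMFDerivAt_fst q
  have hsnd : HasMFDerivAt (model𝒢 n) (𝓘(ℝ, ℝ).prod 𝓘(ℝ, ℝ)) (Prod.snd : Sph n × ℝ × ℝ → ℝ × ℝ) q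
    (ContinuousLinearMap.snd ℝ (E n) (ℝ × ℝ)) := hasMFDerivAt_snd q
  have hcoe := (hasMFDerivAt_coe q.1).comp q hfst
  have h1 : HasMFDerivAt (model𝒢 n) 𝓘(ℝ, E (n + 1) × ℝ × ℝ)
      (fun q : Sph n × ℝ × ℝ => ((q.1 : E (n + 1)), q.2)) q
      (((dcoe q.1).comp (ContinuousLinearMap.fst ℝ (E n) (ℝ × ℝ))).prod
        (ContinuousLinearMap.snd ℝ (E n) (ℝ × ℝ))) :=
    ⟨hcoe.1.prodMk hsnd.1, hcoe.2.prodMk hsnd.2⟩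
  let q' : E (n + 1) × ℝ × ℝ := ((q.1 : E (n + 1)), q.2.1, q.2.2)
  have hy : HasFDerivAt (fun q : E (n + 1) × ℝ × ℝ => q.1)
    (ContinuousLinearMap.fst ℝ (E (n + 1)) (ℝ × ℝ)) q' := hasFDerivAt_fst
  have hs : HasFDerivAt (fun q : E (n + 1) × ℝ × ℝ => q.2.1)
      ((ContinuousLinearMap.fst ℝ ℝ ℝ).comp (ContinuousLinearMap.snd ℝ (E (n + 1)) (ℝ × ℝ))) q' :=
    ((ContinuousLinearMap.fst ℝ ℝ ℝ).comp (ContinuousLinearMap.snd ℝ (E (n + 1)) (ℝ × ℝ))).hasFDerivAt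
  have hρ : HasFDerivAt (fun q : E (n + 1) × ℝ × ℝ => q.2.2)
      ((ContinuousLinearMap.snd ℝ ℝ ℝ).comp (ContinuousLinearMap.snd ℝ (E (n + 1)) (ℝ × ℝ))) q' :=
    ((ContinuousLinearMap.snd ℝ ℝ ℝ).comp (ContinuousLinearMap.snd ℝ (E (n + 1)) (ℝ × ℝ))).hasFDerivAt
  have h2 : HasFDerivAt (fun q : E (n + 1) × ℝ × ℝ =>
      (timeSpace n).symm (q.2.1, (q.2.1 * (1 + q.2.2)) • q.1)) _ q' :=
    (timeSpace n).symm.hasFDerivAt.comp q' (hs.prodMk ((hs.mul (hρ.const_add 1)).smul hy))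
  have h3 := (h2.hasMFDerivAt.comp q h1).mfderiv
  have h4 := congrArg (fun L : E n × ℝ × ℝ →L[ℝ] E (n + 2) => L v) h3
  refine h4.trans ?_
  change (timeSpace n).symm (v.2.1, (q.2.1 * (1 + q.2.2)) • dcoe q.1 v.1
    + (q.2.1 • v.2.2 + (1 + q.2.2) • v.2.1) • (q.1 : E (n + 1))) = _
  congr 4
  simp only [smul_eq_mul]
  ring

/-! ### The flat ambient space of the round sphere. -/

/-- The flat ambient space `U` of the round sphere, restricted to the range of the coordinates. -/
noncomputable def flatAmbient {n : ℕ} (U : Set (E (n + 2))) :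
    AmbientData n (Sph n) (E (n + 2)) where
  dom := {q | 0 < q.2.1 ∧ -1 < q.2.2} ∩ coneCoord n ⁻¹' U
  coord := coneCoord n

/-- Radial and tangential directions are orthogonal, so the spatial part splits into a multiple of
the round metric and a product of radial components. At `ρ = γ = δ = 0` the term `αβ` cancels
against `-αβ`, leaving the tautological tensor. -/
theorem pull_minkowski {n : ℕ} (U : Set (E (n + 2))) (x : Sph n) (t ρ : ℝ) (v w : E n)
    (α β γ δ : ℝ) :
    (flatAmbient U).pull (minkowski n) (x, t, ρ) (v, α, γ) (w, β, δ) =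
      -(α * β) + (t * (1 + ρ)) ^ 2 * roundMetric n x v w
        + (α * (1 + ρ) + t * γ) * (β * (1 + ρ) + t * δ) := by
  have hx : inner ℝ (x : E (n + 1)) (x : E (n + 1)) = (1 : ℝ) := by simp
  have h1 := inner_coe_dcoe x v
  have h2 := inner_coe_dcoe x w
  rw [real_inner_comm] at h1
  have h3 := roundMetric_apply x v w
  rw [h3]
  have h4 (z : ℝ × E (n + 1)) : ((timeSpace n).symm z) 0 = z.1 := rfl
  refine (minkowski_apply n (coneCoord n (x, t, ρ)) _ _).trans ?_
  erw [mfderiv_coneCoord (x, t, ρ) (v, α, γ), mfderiv_coneCoord (x, t, ρ) (w, β, δ)]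
  simp only [ContinuousLinearEquiv.apply_symm_apply, h4,
    inner_add_left, inner_add_right, inner_smul_left, inner_smul_right, h1, h2, hx,
    conj_trivial]
  ring

theorem carrier_flatAmbient_subset {n : ℕ} (U : Set (E (n + 2))) :
    (flatAmbient U).carrier ⊆ U := by
  rintro _ ⟨q, hq, rfl⟩
  exact hq.2

theorem isAmbient_flatAmbient {n : ℕ} {U : Set (E (n + 2))} (hU : IsFlatAmbientDomain U) :
    (flatAmbient U).IsAmbient (roundMetric n) (minkowski n) where
  isOpen_dom := (coneDiffeo n).open_source.inter
    (hU.isOpen.preimage (contMDiff_coneCoord n).continuous)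
  pos q hq := hq.1.1
  dilate x t ρ s hs hq := by
    refine ⟨⟨mul_pos hs hq.1.1, hq.1.2⟩, ?_⟩
    rw [Set.mem_preimage, coneCoord_mul]
    exact hU.dilate _ hq.2 s hs
  zero_section x t ht := by
    refine ⟨⟨ht, by simp⟩, ?_⟩
    rw [Set.mem_preimage, coneCoord_zero]
    exact hU.cone x t ht
  injOn := (coneDiffeo n).injOn.mono Set.inter_subset_left
  -- Here `q` is a point of the domain bundled with its membership proof, and `q.2.1` is the half of
  -- that proof placing it in the source of `coneDiffeo`.
  localDiffeo q := ⟨coneDiffeo n, q.2.1, Set.eqOn_refl _ _⟩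
  pseudoRiemannian := isPseudoRiemannianOn_minkowski n _
  homogeneous x t ρ s _ _ v w α β γ δ := by
    simp only [pull_minkowski]
    ring
  tautological x t _ v w α β := by
    rw [pull_minkowski]
    ring
  ricci_odd _ m := by
    rw [ricci_minkowski]
    exact (flatAmbient U).isO_zero m
  ricci_even _ _ := by
    rw [ricci_minkowski]
    exact (flatAmbient U).isOPlus_zero _ _

/-! ### Homogeneous extensions and evaluation of the operator. -/

theorem flatAmbient_ι {n : ℕ} (U : Set (E (n + 2))) (x : Sph n) (s : ℝ) :
    (flatAmbient U).ι x s = conePoint x s :=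
  coneCoord_zero x s

theorem IsFlatExtension.isHomogeneous {n : ℕ} {U : Set (E (n + 2))} {w : ℝ} {u : Sph n → ℝ}
    {f : E (n + 2) → ℝ} (hf : IsFlatExtension U w u f) : (flatAmbient U).IsHomogeneous w f := by
  refine ⟨(hf.smooth.mono (carrier_flatAmbient_subset U)).contMDiffOn, fun x t ρ s hs hq => ?_⟩
  have h := hf.homogeneous _ hq.2 s hs
  rwa [← coneCoord_mul] at h

/-- Multiplication of a homogeneous extension by a linear coordinate. -/
theorem IsFlatExtension.coord_mul {n : ℕ} {U : Set (E (n + 2))} {w : ℝ} {u : Sph n → ℝ}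
    {f : E (n + 2) → ℝ} (hf : IsFlatExtension U (w - 1) u f) (i : Fin (n + 2)) :
    IsFlatExtension U w (fun x => conePoint x 1 i * u x) (fun p => p i * f p) where
  smooth := ContDiffOn.mul (by fun_prop) hf.smooth
  homogeneous p hp s hs := by
    -- The power `s ^ (w - 1)` is `s ^ w / s`, and the linear coordinate supplies the missing factor
    -- `s`.
    rw [hf.homogeneous p hp s hs, Real.rpow_sub_one hs.ne']
    simp only [PiLp.smul_apply, smul_eq_mul]
    field_simp
  restrict x := by rw [hf.restrict]

theorem contMDiff_xS {n : ℕ} (i : Fin (n + 1)) : ContMDiff (𝓡 n) 𝓘(ℝ, ℝ) ∞ (xS (n := n) i) := by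
  have h : ContDiff ℝ ∞ (fun y : E (n + 1) => y i) := by fun_prop
  exact h.contMDiff.comp (contMDiff_coe_sph n)

theorem conePoint_one_zero {n : ℕ} (x : Sph n) : conePoint x 1 0 = 1 := by
  simp [conePoint]

theorem conePoint_one_succ {n : ℕ} (x : Sph n) (i : Fin (n + 1)) :
    conePoint x 1 i.succ = xS i x := by
  simp [conePoint, xS]

/-- An operator on the round sphere is computed in the flat ambient space. -/
theorem NatOp.DefinesHolographically.eval_headTail {n r : ℕ} {D Dt : NatOp (r - 1)} {a b : ℝ}
    (hDt : Dt.DefinesHolographically D n (fun _ => a) b) {U : Set (E (n + 2))}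
    (hU : IsFlatAmbientDomain U) {u v : Sph n → ℝ} (hu : ContMDiff (𝓡 n) 𝓘(ℝ, ℝ) ∞ u)
    (hv : ContMDiff (𝓡 n) 𝓘(ℝ, ℝ) ∞ v) {ut vt : E (n + 2) → ℝ}
    (hut : IsFlatExtension U a u ut) (hvt : IsFlatExtension U a v vt) (x : Sph n) :
    D.eval (roundMetric n) (headTail u v) x
      = Dt.eval (minkowski n) (headTail ut vt) (conePoint x 1) := by
  rw [← flatAmbient_ι U]
  refine hDt.induces (Sph n) (E (n + 2)) (flatAmbient U) (roundMetric n) (minkowski n)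
    (isRiemannian_roundMetric n) (isAmbient_flatAmbient hU) _ _ (fun j => ?_) (fun j => ?_)
    (fun j y => ?_) x
  · unfold headTail
    split_ifs
    exacts [hu, hv]
  · unfold headTail
    split_ifs
    exacts [hut.isHomogeneous, hvt.isHomogeneous]
  · rw [flatAmbient_ι]
    unfold headTail
    split_ifs
    exacts [hut.restrict y, hvt.restrict y]

/-- Multiplying the first argument by `x^i` changes only the head, so both terms of the commutator
have the form handled by `eval_headTail`. -/
theorem update_headTail {r : ℕ} {M : Type} (h : 0 < r - 1) (u v f : M → ℝ) :
    Function.update (headTail (r := r) u v) ⟨0, h⟩ f = headTail f v := by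
  funext j
  by_cases hj : j = ⟨0, h⟩
  · subst hj
    simp [headTail]
  · have hj' : (j : ℕ) ≠ 0 := fun h' => hj (Fin.ext h')
    simp [Function.update_of_ne hj, headTail, hj']

end Ambient

/-! ### The commutator identity. -/

theorem lemma3p3 (n k r : ℕ) (hr : 2 ≤ r) (D Dt : NatOp (r - 1))
    (hsa : D.IsFormallySelfAdjoint n) (hcc : D.IsConformallyCovariant n)
    (hhom : D.HasHomogeneity n (-2 * k))
    (hDt : Dt.DefinesHolographically D n (fun _ => -((n - 2 * k : ℝ) / r))
      (-(((r - 1 : ℝ) * n + 2 * k) / r)))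
    (U : Set (E (n + 2))) (hU : IsFlatAmbientDomain U)
    (u v : Sph n → ℝ) (hu : ContMDiff (𝓡 n) 𝓘(ℝ, ℝ) ∞ u) (hv : ContMDiff (𝓡 n) 𝓘(ℝ, ℝ) ∞ v)
    (ut vt : E (n + 2) → ℝ)
    (hut : IsFlatExtension U (-((n - 2 * k : ℝ) / r) - 1) u ut)
    (hvt : IsFlatExtension U (-((n - 2 * k : ℝ) / r)) v vt) (x : Sph n) :
    ∑ i : Fin (n + 1), xS i x *
        slotCommutator (D.eval (roundMetric n)) (xS i) ⟨0, Nat.sub_pos_of_lt hr⟩ (headTail u v) x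
      = ∑ i : Fin (n + 1),
          (xM i (conePoint x 1) * tM (conePoint x 1) *
              Dt.eval (minkowski n) (headTail (fun p => xM i p * ut p) vt) (conePoint x 1)
            - xM i (conePoint x 1) ^ 2 *
              Dt.eval (minkowski n) (headTail (fun p => tM p * ut p) vt) (conePoint x 1)) := by
  refine Finset.sum_congr rfl fun i _ => ?_
  -- Because `t̃ = 1` on the section representing the round metric, multiplication by `t̃` corrects
  -- the weight without changing the restriction.
  have ht : IsFlatExtension U (-((n - 2 * k : ℝ) / r)) u (fun p => tM p * ut p) := by
    have h := hut.coord_mul 0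
    simp only [conePoint_one_zero, one_mul] at h
    exact h
  have hx : IsFlatExtension U (-((n - 2 * k : ℝ) / r)) (fun q => xS i q * u q)
      (fun p => xM i p * ut p) := by
    have h := hut.coord_mul i.succ
    simp only [conePoint_one_succ] at h
    exact h
  have h0 : headTail (r := r) u v ⟨0, Nat.sub_pos_of_lt hr⟩ = u := rfl
  have hxu : ContMDiff (𝓡 n) 𝓘(ℝ, ℝ) ∞ (fun q => xS i q * u q) := (contMDiff_xS i).mul hu
  have h1 : xM i (conePoint x 1) = xS i x := conePoint_one_succ x i
  have h2 : tM (conePoint x 1) = 1 := conePoint_one_zero x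
  simp only [slotCommutator, update_headTail, h0]
  -- Both ambient values become values of `D` on the sphere. With `t̃ = 1` and `x̃^i = x^i` at the
  -- point, what remains is the expanded commutator.
  rw [← hDt.eval_headTail hU hu hv ht hvt,
    ← hDt.eval_headTail hU hxu hv hx hvt, h1, h2]
  ring
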